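/- Let $J(x,y,p)$ be a real-valued function that is real-analytic in a neighbourhood of the origin of $\mathbb{R}^3$. Then there are a real-analytic function $\varphi(x)$ near $0\in\mathbb{R}$, a real-analytic function $\psi(x,y)$ near $(0,0)\in\mathbb{R}^2$ and a real-analytic function $K(x,y,p)$ near $(0,0,0)\in\mathbb{R}^3$ with the following properties. (a) $\varphi(0)=0$, $\psi(0,0)=0$, $\varphi_x(0)\neq 0$ and $\psi_y(0,0)\neq 0$. That is, $X=\varphi(x)$, $Y=\psi(x,y)$ is an analytic fibre-preserving local diffeomorphism of the plane fixing the origin. (b) This map transforms the equation $Y_{XX}=J(X,Y,P)$, where $P=Y_X$, into $y_{xx}=K(x,y,p)$, where $p=y_x$, near the origin. Precisely, let $$P=\frac{\psi_x+\psi_y\,p}{\varphi_x},\qquad Y_{XX}=\frac{\varphi_x\psi_{yy}p^2+2\varphi_x\psi_{xy}p+\varphi_x\psi_{xx}-(\psi_x+\psi_y p)\varphi_{xx}+\psi_y\varphi_x\,y_{xx}}{\varphi_x^3}$$ be the remaining components of the second prolongation of the map. Then $P=0$ at $(x,y,p)=(0,0,0)$, and for all $(x,y,p)$ in a neighbourhood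 of the origin and all $y_{xx}\in\mathbb{R}$ one has $$Y_{XX}=J(\varphi(x),\psi(x,y),P)\iff y_{xx}=K(x,y,p).$$ (c) $K$ is in normal form: on neighbourhoods of the origin in the remaining variables, - D1. $K(x,y,0)\equiv 0$, - D2. $K_p(0,y,0)\equiv 0$, - D3. $K_p(x,0,0)\equiv 0$, - D4. $K_{pp}(0,y,0)\equiv 0$. -/

import Mathlib

open Filter Topology

namespace SecondOrderODE

/-- The partial derivative of `ψ (x, y)` with respect to the first variable. -/
noncomputable def partialX (ψ : ℝ → ℝ → ℝ) (x y : ℝ) : ℝ := deriv (fun t => ψ t y) x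

/-- The partial derivative of `ψ (x, y)` with respect to the second variable. -/
noncomputable def partialY (ψ : ℝ → ℝ → ℝ) (x y : ℝ) : ℝ := deriv (fun t => ψ x t) y

/-- The partial derivative of `K (x, y, p)` with respect to `p`. -/
noncomputable def partialP (K : ℝ → ℝ → ℝ → ℝ) (x y p : ℝ) : ℝ := deriv (fun t => K x y t) p

/-- `J (x, y, p)` is given near the origin by a convergent power series in `(x, y, p)`. -/
def AnalyticAtOrigin (J : ℝ → ℝ → ℝ → ℝ) : Prop :=
  AnalyticAt ℝ (fun q : ℝ × ℝ × ℝ => J q.1 q.2.1 q.2.2) 0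

/-- The hypersurface `y_xx = J (x, y, p)` in the second order jet space, whose points are
written `(x, y, p, y_xx)`. -/
def equationManifold (J : ℝ → ℝ → ℝ → ℝ) : Set (ℝ × ℝ × ℝ × ℝ) :=
  {z | z.2.2.2 = J z.1 z.2.1 z.2.2.1}

/-- `X = φ x`, `Y = ψ (x, y)` is an analytic fibre-preserving local diffeomorphism of the plane
that fixes the origin. Its Jacobian determinant at the origin is `φ_x * ψ_y`. -/
structure IsFibrePreservingAtOrigin (φ : ℝ → ℝ) (ψ : ℝ → ℝ → ℝ) : Prop where
  analytic_fst : AnalyticAt ℝ φ 0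
  analytic_snd : AnalyticAt ℝ (fun q : ℝ × ℝ => ψ q.1 q.2) 0
  fst_origin : φ 0 = 0
  snd_origin : ψ 0 0 = 0
  fst_deriv_ne_zero : deriv φ 0 ≠ 0
  snd_partialY_ne_zero : partialY ψ 0 0 ≠ 0

/-- The component `P = D_x Y / D_x X` of the prolongation of `X = φ x`, `Y = ψ (x, y)`. -/
noncomputable def prolongP (φ : ℝ → ℝ) (ψ : ℝ → ℝ → ℝ) (x y p : ℝ) : ℝ :=
  (partialX ψ x y + partialY ψ x y * p) / deriv φ x

/-- The component `Y_XX = D_x P / D_x X` of the prolongation of `X = φ x`, `Y = ψ (x, y)`,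
where `u` stands for `y_xx`. -/
noncomputable def prolongYXX (φ : ℝ → ℝ) (ψ : ℝ → ℝ → ℝ) (x y p u : ℝ) : ℝ :=
  (deriv φ x * partialY (partialY ψ) x y * p ^ 2
      + 2 * deriv φ x * partialY (partialX ψ) x y * p
      + deriv φ x * partialX (partialX ψ) x y
      + (-partialX ψ x y - partialY ψ x y * p) * deriv (deriv φ) x
      + partialY ψ x y * deriv φ x * u) / deriv φ x ^ 3

/-- The second prolongation `(x, y, p, y_xx) ↦ (X, Y, P, Y_XX)` of `X = φ x`, `Y = ψ (x, y)`. -/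
noncomputable def prolongation (φ : ℝ → ℝ) (ψ : ℝ → ℝ → ℝ) (z : ℝ × ℝ × ℝ × ℝ) :
    ℝ × ℝ × ℝ × ℝ :=
  (φ z.1, ψ z.1 z.2.1, prolongP φ ψ z.1 z.2.1 z.2.2.1,
    prolongYXX φ ψ z.1 z.2.1 z.2.2.1 z.2.2.2)

/-- The change of variables `X = φ x`, `Y = ψ (x, y)` turns the equation `Y_XX = J (X, Y, P)`,
considered near the origin, into `y_xx = K (x, y, p)`: its first prolongation fixes the origin
of the `(x, y, p)`-space, and, over a neighbourhood of that origin, the second prolongation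
identifies the hypersurface of the second equation with the preimage of that of the first. -/
def Transforms (φ : ℝ → ℝ) (ψ : ℝ → ℝ → ℝ) (J K : ℝ → ℝ → ℝ → ℝ) : Prop :=
  (φ 0 = 0 ∧ ψ 0 0 = 0 ∧ prolongP φ ψ 0 0 0 = 0) ∧
  ∀ᶠ q : ℝ × ℝ × ℝ in 𝓝 0, ∀ u : ℝ,
    prolongation φ ψ (q.1, q.2.1, q.2.2, u) ∈ equationManifold J ↔
      (q.1, q.2.1, q.2.2, u) ∈ equationManifold K

/-- The equation `y_xx = K (x, y, p)` is in normal form (near the origin). -/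
structure IsNormalForm (K : ℝ → ℝ → ℝ → ℝ) : Prop where
  D1 : ∀ᶠ q : ℝ × ℝ in 𝓝 0, K q.1 q.2 0 = 0
  D2 : ∀ᶠ y : ℝ in 𝓝 0, partialP K 0 y 0 = 0
  D3 : ∀ᶠ x : ℝ in 𝓝 0, partialP K x 0 0 = 0
  D4 : ∀ᶠ y : ℝ in 𝓝 0, partialP (partialP K) 0 y 0 = 0

end SecondOrderODE

namespace SecondOrderODE

/-! ### Analyticity of superposition operators on spaces of continuous functions. -/

section Superposition

/-! D1 says that the lines `y = const` solve the new equation. So one takes a family of solutions `X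
↦ F X y` of the old equation with `F_Y(0,0) = 1` and puts `ψ x y = F (φ x) y`. Still free are the
Cauchy data of `F` on `X = 0` and the function `φ`.

If `φ'(0) = 1` and `φ''(0) = 0`, then D2 and D4 read `F_XY = F_Y J_P / 2` and `F_YY = F_Y² J_PP / 2`
on `X = 0`, which is a first-order system in `y` for the triple `(F, F_Y, F_X)(0, y)`. D3 becomes
`φ'' = -φ'² k(φ)` with `k = J_P - 2 F_XY / F_Y` taken on the solution `y = 0`. The condition for D2
at the origin gives `k(0) = 0`, hence `φ''(0) = 0`, so the choices are compatible.
`exists_solution_family` and `exists_reparametrization` solve these equations; `exists_normalForm`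
combines them.

All of this needs ODE solutions that are jointly analytic in time and initial value
(`exists_analyticAt_flow`). They come from the analytic implicit function theorem in `C(I, E)`,
applied to `y = a + t ∫ f ∘ y`; its input is `exists_analyticAt_superposition`. -/

theorem update_continuousMap_apply {X E : Type*} [TopologicalSpace X] [TopologicalSpace E]
    {n : ℕ} [DecidableEq (Fin n)] (h : Fin n → C(X, E))
    (i : Fin n) (c : C(X, E)) (x : X) :
    (fun j => Function.update h i c j x) = Function.update (fun j => h j x) i (c x) := by
  ext j
  rcases eq_or_ne j i with rfl | hj
  · simp
  · simp [hj]

variable {X E F : Type*} [TopologicalSpace X] [CompactSpace X]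
  [NormedAddCommGroup E] [NormedSpace ℝ E] [NormedAddCommGroup F] [NormedSpace ℝ F]

/-- Pointwise application of a continuous multilinear map to continuous functions. -/
noncomputable def pointwiseMultilinear {n : ℕ}
    (m : ContinuousMultilinearMap ℝ (fun _ : Fin n => E) F) :
    ContinuousMultilinearMap ℝ (fun _ : Fin n => C(X, E)) C(X, F) :=
  MultilinearMap.mkContinuous
    { toFun := fun h => ⟨fun x => m fun i => h i x, by fun_prop⟩
      map_update_add' := by
        intro _ h i a b
        ext x
        simp [update_continuousMap_apply]
      map_update_smul' := by
        intro _ h i c a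
        ext x
        simp [update_continuousMap_apply] }
    ‖m‖ (by
      intro h
      refine (ContinuousMap.norm_le _ (by positivity)).2 fun x => ?_
      refine (m.le_opNorm _).trans ?_
      gcongr with i
      exact (h i).norm_coe_le_norm x)

@[simp] theorem pointwiseMultilinear_apply {n : ℕ}
    (m : ContinuousMultilinearMap ℝ (fun _ : Fin n => E) F) (h : Fin n → C(X, E)) (x : X) :
    pointwiseMultilinear m h x = m fun i => h i x := rfl

theorem norm_pointwiseMultilinear_le {n : ℕ}
    (m : ContinuousMultilinearMap ℝ (fun _ : Fin n => E) F) :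
    ‖pointwiseMultilinear (X := X) m‖ ≤ ‖m‖ :=
  MultilinearMap.mkContinuous_norm_le _ (norm_nonneg _) _

/-- The superposition operator `y ↦ f ∘ y` of an analytic function `f` is analytic. -/
theorem exists_analyticAt_superposition [CompleteSpace F] {f : E → F} {a : E}
    (hf : AnalyticAt ℝ f a) :
    ∃ N : C(X, E) → C(X, F), AnalyticAt ℝ N (ContinuousMap.const X a) ∧
      ∀ᶠ y in 𝓝 (ContinuousMap.const X a), ∀ x, N y x = f (y x) := by
  obtain ⟨p, r, hp⟩ := hf
  let q : FormalMultilinearSeries ℝ C(X, E) C(X, F) := fun n => pointwiseMultilinear (p n)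
  -- Passing to pointwise application does not increase the norms of the coefficients, so the series
  -- on `C(X, E)` converges at least as far as that of `f`.
  have hr : p.radius ≤ q.radius :=
    FormalMultilinearSeries.radius_le_of_le fun n => norm_pointwiseMultilinear_le _
  have hpos : 0 < q.radius := (hp.r_pos.trans_le hp.r_le).trans_le hr
  have hq := (q.hasFPowerSeriesOnBall hpos).comp_sub (ContinuousMap.const X a)
  rw [zero_add] at hq
  refine ⟨_, hq.analyticAt, ?_⟩
  filter_upwards [Metric.eball_mem_nhds (ContinuousMap.const X a) hp.r_pos] with y hy x
  have hy' : y ∈ Metric.eball (ContinuousMap.const X a) q.radius :=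
    Metric.eball_subset_eball (hp.r_le.trans hr) hy
  have h1 := hq.hasSum_sub hy'
  have h2 : y x ∈ Metric.eball a r := by
    refine lt_of_le_of_lt ?_ (Metric.mem_eball.1 hy)
    rw [edist_dist, edist_dist]
    exact ENNReal.ofReal_le_ofReal (ContinuousMap.dist_apply_le_dist (f := y)
      (g := ContinuousMap.const X a) x)
  have h3 := hp.hasSum_sub h2
  -- Evaluation at `x` is continuous and linear, so it turns the series in `C(X, F)` into the series
  -- of `f` at `y x`.
  have h4 := h1.mapL (ContinuousMap.evalCLM ℝ x)
  exact h4.unique h3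

end Superposition

/-! ### Analytic dependence of ODE solutions on time and initial value. -/

section Flow

open unitInterval MeasureTheory

variable {E : Type*} [NormedAddCommGroup E] [NormedSpace ℝ E]

/-- The operator `y ↦ ∫₀ˢ y` on the continuous functions on the unit interval. -/
noncomputable def primitive : C(I, E) →L[ℝ] C(I, E) :=
  LinearMap.mkContinuous
    { toFun := fun y => ⟨fun s : I => ∫ r in (0 : ℝ)..s, Set.IccExtend zero_le_one y r, by
        have h : Continuous (Set.IccExtend (zero_le_one' ℝ) y) := y.continuous.Icc_extend'
        exact (intervalIntegral.continuous_primitive (fun a b => h.intervalIntegrable a b)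
          0).comp continuous_subtype_val⟩
      map_add' := fun y z => by
        ext s
        have hy : Continuous (Set.IccExtend (zero_le_one' ℝ) y) := y.continuous.Icc_extend'
        have hz : Continuous (Set.IccExtend (zero_le_one' ℝ) z) := z.continuous.Icc_extend'
        exact intervalIntegral.integral_add (hy.intervalIntegrable _ _)
          (hz.intervalIntegrable _ _)
      map_smul' := fun c y => by
        ext s
        exact intervalIntegral.integral_smul c _ }
    1 (by
      intro y
      refine (ContinuousMap.norm_le _ (by positivity)).2 fun s => ?_
      refine (intervalIntegral.norm_integral_le_of_norm_le_const (C := ‖y‖)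
        fun r _ => y.norm_coe_le_norm _).trans ?_
      have h0 := s.2.1
      have h1 := s.2.2
      rw [sub_zero, abs_of_nonneg h0, one_mul]
      exact mul_le_of_le_one_right (norm_nonneg _) h1)

theorem primitive_apply (y : C(I, E)) (s : I) :
    primitive y s = ∫ r in (0 : ℝ)..s, Set.IccExtend zero_le_one y r := rfl

variable [CompleteSpace E]

/-- Near a point where the vector field `f` is analytic, the rescaled integral equation
`y = a + t ∫₀ f ∘ y` on the unit interval has a unique small solution, which depends
analytically on `(t, a)`. -/
theorem exists_analyticAt_solution {f : E → E} {a₀ : E} (hf : AnalyticAt ℝ f a₀) :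
    ∃ (N : C(I, E) → C(I, E)) (S : ℝ × E → C(I, E)),
      (∀ᶠ y in 𝓝 (ContinuousMap.const I a₀), ∀ s, N y s = f (y s)) ∧
      AnalyticAt ℝ S (0, a₀) ∧ S (0, a₀) = ContinuousMap.const I a₀ ∧
      ∀ᶠ v : (ℝ × E) × C(I, E) in 𝓝 ((0, a₀), ContinuousMap.const I a₀),
        v.2 = ContinuousMap.const I v.1.2 + v.1.1 • primitive (N v.2) ↔ S v.1 = v.2 := by
  obtain ⟨N, hN, hNf⟩ := exists_analyticAt_superposition (X := I) hf
  let cst : E →L[ℝ] C(I, E) := ContinuousLinearMap.const ℝ I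
  let u : (ℝ × E) × C(I, E) := ((0, a₀), ContinuousMap.const I a₀)
  let G : (ℝ × E) × C(I, E) → C(I, E) :=
    fun v => v.2 - cst v.1.2 - v.1.1 • primitive (N v.2)
  have hG : AnalyticAt ℝ G u := by
    have h2 : AnalyticAt ℝ (fun v : (ℝ × E) × C(I, E) => N v.2) u :=
      AnalyticAt.fun_comp (g := N) (f := Prod.snd) hN analyticAt_snd
    have h3 : AnalyticAt ℝ (fun v : (ℝ × E) × C(I, E) => primitive (N v.2)) u :=
      (primitive.analyticAt _).fun_comp h2
    have h4 : AnalyticAt ℝ (fun v : (ℝ × E) × C(I, E) => v.1.1) u :=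
      analyticAt_fst.fun_comp analyticAt_fst
    have h5 : AnalyticAt ℝ (fun v : (ℝ × E) × C(I, E) => cst v.1.2) u :=
      (cst.analyticAt _).fun_comp (analyticAt_snd.fun_comp analyticAt_fst)
    exact (analyticAt_snd.sub h5).sub (h4.smul h3)
  have hGu : G u = 0 := by
    ext s
    simp [G, u, cst]
  -- Here `⊤ : WithTop ℕ∞` is `ω`, so the implicit function obtained from it is analytic, not merely
  -- smooth.
  have hGc : ContDiffAt ℝ ⊤ G u := hG.contDiffAt
  -- At `t = 0` the integral term vanishes identically in `y`, so the partial derivative in `y` is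
  -- the identity.
  have hd : fderiv ℝ G u ∘L .inr ℝ (ℝ × E) C(I, E) = ContinuousLinearMap.id ℝ C(I, E) := by
    have h1 : HasFDerivAt (fun y => G ((0, a₀), y))
        (fderiv ℝ G u ∘L .inr ℝ (ℝ × E) C(I, E)) (ContinuousMap.const I a₀) :=
      HasFDerivAt.comp (g := G) _ hG.differentiableAt.hasFDerivAt
        (hasFDerivAt_prodMk_right (0, a₀) (ContinuousMap.const I a₀))
    have h2 : HasFDerivAt (fun y => G ((0, a₀), y)) (ContinuousLinearMap.id ℝ C(I, E))
        (ContinuousMap.const I a₀) := by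
      simp only [G, zero_smul, sub_zero]
      exact (hasFDerivAt_id _).sub_const _
    exact h1.unique h2
  have hinv : (fderiv ℝ G u ∘L .inr ℝ (ℝ × E) C(I, E)).IsInvertible := by
    rw [hd]
    exact ⟨ContinuousLinearEquiv.refl ℝ _, rfl⟩
  refine ⟨N, hGc.implicitFunction (by simp) hinv, hNf, ?_, ?_, ?_⟩
  · exact (hGc.contDiffAt_implicitFunction (by simp) hinv).analyticAt
  · exact hGc.implicitFunction_apply_self (by simp) hinv
  · filter_upwards [hGc.eventually_apply_eq_iff_implicitFunction (by simp) hinv] with v hv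
    rw [← hv, hGu]
    simp only [G]
    rw [sub_sub, sub_eq_zero]
    rfl

/-- The local flow of an analytic vector field is analytic in time and initial value. -/
theorem exists_analyticAt_flow {f : E → E} {a₀ : E} (hf : AnalyticAt ℝ f a₀) :
    ∃ Φ : ℝ × E → E, AnalyticAt ℝ Φ (0, a₀) ∧
      (∀ᶠ a in 𝓝 a₀, Φ (0, a) = a) ∧
      ∀ᶠ q : ℝ × E in 𝓝 (0, a₀), HasDerivAt (fun t => Φ (t, q.2)) (f (Φ q)) q.1 := by
  obtain ⟨N, S, hN, hS, hS0, huniq⟩ := exists_analyticAt_solution hf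
  have hfc : ∀ᶠ z in 𝓝 a₀, ContinuousAt f z :=
    hf.eventually_analyticAt.mono fun z hz => hz.continuousAt
  obtain ⟨ε, hε, hεP⟩ : ∃ ε > 0, ∀ (t : ℝ) (a : E) (y : C(I, E)), dist t 0 < ε → dist a a₀ < ε →
      dist y (ContinuousMap.const I a₀) < ε → (∀ s, N y s = f (y s)) ∧
      (∀ z, dist z a₀ < ε → ContinuousAt f z) ∧
      (y = ContinuousMap.const I a + t • primitive (N y) ↔ S (t, a) = y) := by
    obtain ⟨ε₁, h₁, H₁⟩ := Metric.eventually_nhds_iff.1 hN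
    obtain ⟨ε₂, h₂, H₂⟩ := Metric.eventually_nhds_iff.1 hfc
    obtain ⟨ε₃, h₃, H₃⟩ := Metric.eventually_nhds_iff.1 huniq
    refine ⟨min ε₁ (min ε₂ ε₃), by positivity, fun t a y ht ha hy => ?_⟩
    simp only [lt_min_iff] at ht ha hy
    refine ⟨H₁ hy.1, fun z hz => H₂ ?_, H₃ (y := ((t, a), y)) ?_⟩
    · simp only [lt_min_iff] at hz
      exact hz.2.1
    · rw [Prod.dist_eq, Prod.dist_eq]
      exact max_lt (max_lt ht.2.2 ha.2.2) hy.2.2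
  obtain ⟨δ, hδ, hδP⟩ : ∃ δ > 0, δ ≤ ε ∧ ∀ (t : ℝ) (a : E), dist t 0 < δ → dist a a₀ < δ →
      dist (S (t, a)) (ContinuousMap.const I a₀) < ε := by
    have hc : ∀ᶠ q in 𝓝 ((0 : ℝ), a₀), dist (S q) (ContinuousMap.const I a₀) < ε := by
      have := hS.continuousAt.eventually (Metric.ball_mem_nhds _ hε)
      rwa [hS0] at this
    obtain ⟨δ, h, H⟩ := Metric.eventually_nhds_iff.1 hc
    refine ⟨min δ ε, by positivity, min_le_right _ _, fun t a ht ha => H ?_⟩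
    rw [Prod.dist_eq]
    exact max_lt (ht.trans_le (min_le_left _ _)) (ha.trans_le (min_le_left _ _))
  obtain ⟨hδε, hδS⟩ := hδP
  -- every solution satisfies the integral equation
  have hint : ∀ (t : ℝ) (a : E), dist t 0 < δ → dist a a₀ < δ → ∀ s : I,
      S (t, a) s = a + t • ∫ r in (0 : ℝ)..s, f (Set.IccExtend zero_le_one (S (t, a)) r) := by
    intro t a ht ha s
    obtain ⟨h1, -, h2⟩ := hεP t a _ (ht.trans_le hδε) (ha.trans_le hδε) (hδS t a ht ha)
    have h3 := congrArg (fun y : C(I, E) => y s) (h2.2 rfl)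
    simp only [ContinuousMap.add_apply, ContinuousMap.smul_apply, ContinuousMap.const_apply,
      primitive_apply] at h3
    rw [h3]
    congr 2
    refine intervalIntegral.integral_congr fun r _ => ?_
    exact h1 _
  -- rescaling a solution gives a solution
  have hscale : ∀ (t : ℝ) (a : E), dist t 0 < δ → dist a a₀ < δ → ∀ s : I,
      S (t * s, a) 1 = S (t, a) s := by
    intro t a ht ha s
    let y := S (t, a)
    let z : C(I, E) := ⟨fun r => y (s * r), by fun_prop⟩
    have hts : dist (t * s) 0 < δ := by
      rw [Real.dist_0_eq_abs] at ht ⊢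
      rw [abs_mul, abs_of_nonneg s.2.1]
      exact (mul_le_of_le_one_right (abs_nonneg _) s.2.2).trans_lt ht
    have hz : dist z (ContinuousMap.const I a₀) < ε := by
      refine lt_of_le_of_lt ?_ (hδS t a ht ha)
      refine (ContinuousMap.dist_le dist_nonneg).2 fun r => ?_
      exact ContinuousMap.dist_apply_le_dist (f := y) (g := ContinuousMap.const I a₀) (s * r)
    obtain ⟨h1, -, h2⟩ := hεP (t * s) a z (hts.trans_le hδε) (ha.trans_le hδε) hz
    have h3 : z = ContinuousMap.const I a + (t * (s : ℝ)) • primitive (N z) := by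
      ext r
      simp only [ContinuousMap.add_apply, ContinuousMap.smul_apply, ContinuousMap.const_apply,
        primitive_apply]
      have h4 : z r = y (s * r) := rfl
      rw [h4, hint t a ht ha]
      congr 1
      rw [mul_smul]
      congr 1
      have h5 : (∫ τ in (0 : ℝ)..r, Set.IccExtend zero_le_one (N z) τ)
          = ∫ τ in (0 : ℝ)..r, f (Set.IccExtend zero_le_one y ((s : ℝ) * τ)) := by
        refine intervalIntegral.integral_congr fun τ hτ => ?_
        rw [Set.uIcc_of_le r.2.1] at hτ
        have hτI : τ ∈ I := ⟨hτ.1, hτ.2.trans r.2.2⟩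
        have hsτ : (s : ℝ) * τ ∈ I := (s * ⟨τ, hτI⟩ : I).2
        simp only [Set.IccExtend_of_mem _ _ hτI, Set.IccExtend_of_mem _ _ hsτ]
        exact h1 _
      rw [h5, intervalIntegral.smul_integral_comp_mul_left
        (fun τ => f (Set.IccExtend zero_le_one y τ))]
      simp
      rfl
    -- Local uniqueness in the implicit function theorem identifies the rescaled curve with the
    -- solution for time `t * s`.
    have h6 : S (t * s, a) = z := h2.1 h3
    rw [h6]
    change y (s * 1) = y s
    rw [mul_one]
  -- The unit interval stands for the time interval from `0` to `t`, so its endpoint `1` is time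
  -- `t`.
  let Φ : ℝ × E → E := fun q => S q 1
  have hΦ : AnalyticAt ℝ Φ (0, a₀) :=
    ((ContinuousMap.evalCLM ℝ (1 : I)).analyticAt _).fun_comp hS
  have hΦint : ∀ (t : ℝ) (a : E), dist t 0 < δ → dist a a₀ < δ →
      Φ (t, a) = a + ∫ τ in (0 : ℝ)..t, f (Φ (τ, a)) := by
    intro t a ht ha
    have h1 : (∫ r in (0 : ℝ)..1, f (Set.IccExtend zero_le_one (S (t, a)) r))
        = ∫ r in (0 : ℝ)..1, f (Φ (t * r, a)) := by
      refine intervalIntegral.integral_congr fun r hr => ?_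
      rw [Set.uIcc_of_le zero_le_one] at hr
      simp only [Set.IccExtend_of_mem _ _ hr]
      exact congrArg f (hscale t a ht ha ⟨r, hr⟩).symm
    have h2 := hint t a ht ha 1
    simp only [Set.Icc.coe_one] at h2
    rw [h1, intervalIntegral.smul_integral_comp_mul_left (fun τ => f (Φ (τ, a)))] at h2
    simpa using h2
  refine ⟨Φ, hΦ, ?_, ?_⟩
  · filter_upwards [Metric.ball_mem_nhds a₀ hδ] with a ha
    simpa using hΦint 0 a (by simpa using hδ) ha
  · obtain ⟨η, hη, hηP⟩ := Metric.eventually_nhds_iff.1 hΦ.eventually_analyticAt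
    -- `δ` secures the integral equation and `η` the continuity of `Φ`; a product of balls contains
    -- the whole time segment from `0` to `t`.
    have hmem : Metric.ball (0 : ℝ) (min δ η) ×ˢ Metric.ball a₀ (min δ η) ∈ 𝓝 ((0 : ℝ), a₀) :=
      prod_mem_nhds (Metric.ball_mem_nhds _ (by positivity)) (Metric.ball_mem_nhds _ (by positivity))
    filter_upwards [hmem] with q hq
    obtain ⟨t, a⟩ := q
    obtain ⟨ht, ha⟩ := hq
    simp only [Metric.mem_ball, lt_min_iff] at ht ha
    have hcont : ContinuousOn (fun τ => f (Φ (τ, a))) (Metric.ball 0 (min δ η)) := by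
      intro τ hτ
      simp only [Metric.mem_ball, lt_min_iff] at hτ
      have h1 : ContinuousAt Φ (τ, a) := by
        refine (hηP ?_).continuousAt
        rw [Prod.dist_eq]
        exact max_lt hτ.2 ha.2
      have h2 : ContinuousAt f (Φ (τ, a)) := by
        refine (hεP τ a _ (hτ.1.trans_le hδε) (ha.1.trans_le hδε) (hδS τ a hτ.1 ha.1)).2.1 _ ?_
        exact (ContinuousMap.dist_apply_le_dist (f := S (τ, a))
          (g := ContinuousMap.const I a₀) 1).trans_lt (hδS τ a hτ.1 ha.1)
      have h3 : ContinuousAt (fun τ : ℝ => (τ, a)) τ := by fun_prop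
      exact (ContinuousAt.comp (g := f) (f := fun τ => Φ (τ, a)) h2
        (ContinuousAt.comp (g := Φ) h1 h3)).continuousWithinAt
    have htb : t ∈ Metric.ball (0 : ℝ) (min δ η) := lt_min ht.1 ht.2
    have hsub : Set.uIcc 0 t ⊆ Metric.ball (0 : ℝ) (min δ η) :=
      (convex_ball (0 : ℝ) _).ordConnected.uIcc_subset
        (Metric.mem_ball_self (by positivity)) htb
    have hderiv : HasDerivAt (fun s => a + ∫ τ in (0 : ℝ)..s, f (Φ (τ, a))) (f (Φ (t, a))) t := by
      refine HasDerivAt.const_add a ?_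
      exact intervalIntegral.integral_hasDerivAt_right
        (hcont.mono hsub).intervalIntegrable
        (hcont.stronglyMeasurableAtFilter Metric.isOpen_ball t htb)
        (hcont.continuousAt (Metric.isOpen_ball.mem_nhds htb))
    refine hderiv.congr_of_eventuallyEq ?_
    filter_upwards [Metric.isOpen_ball.mem_nhds (show t ∈ Metric.ball (0 : ℝ) δ from ht.1)]
      with s hs
    exact hΦint s a hs ha.1

end Flow

/-! ### Partial derivatives of analytic functions and restriction of local identities. -/

section Partial

theorem hasDerivAt_fst_comp {A B : Type*} [NormedAddCommGroup A] [NormedSpace ℝ A]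
    [NormedAddCommGroup B] [NormedSpace ℝ B] {c : ℝ → A × B} {c' : A × B} {t : ℝ}
    (h : HasDerivAt c c' t) : HasDerivAt (fun t => (c t).1) c'.1 t :=
  (ContinuousLinearMap.fst ℝ A B).hasFDerivAt.comp_hasDerivAt t h

theorem hasDerivAt_snd_comp {A B : Type*} [NormedAddCommGroup A] [NormedSpace ℝ A]
    [NormedAddCommGroup B] [NormedSpace ℝ B] {c : ℝ → A × B} {c' : A × B} {t : ℝ}
    (h : HasDerivAt c c' t) : HasDerivAt (fun t => (c t).2) c'.2 t :=
  (ContinuousLinearMap.snd ℝ A B).hasFDerivAt.comp_hasDerivAt t h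

/-- `F (x, y)` is given near the origin by a convergent power series in `(x, y)`. -/
def AnalyticAtOrigin₂ (F : ℝ → ℝ → ℝ) : Prop :=
  AnalyticAt ℝ (fun q : ℝ × ℝ => F q.1 q.2) 0

variable {F G : ℝ → ℝ → ℝ} {J K : ℝ → ℝ → ℝ → ℝ}

theorem hasDerivAt_slice_fst {f : ℝ × ℝ → ℝ} {q : ℝ × ℝ} {f' : ℝ × ℝ →L[ℝ] ℝ}
    (h : HasFDerivAt f f' q) : HasDerivAt (fun t => f (t, q.2)) (f' (1, 0)) q.1 :=
  HasFDerivAt.comp_hasDerivAt (l := f) q.1 h ((hasDerivAt_id q.1).prodMk (hasDerivAt_const q.1 q.2))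

theorem hasDerivAt_slice_snd {f : ℝ × ℝ → ℝ} {q : ℝ × ℝ} {f' : ℝ × ℝ →L[ℝ] ℝ}
    (h : HasFDerivAt f f' q) : HasDerivAt (fun t => f (q.1, t)) (f' (0, 1)) q.2 :=
  HasFDerivAt.comp_hasDerivAt (l := f) q.2 h ((hasDerivAt_const q.2 q.1).prodMk (hasDerivAt_id q.2))

theorem hasDerivAt_slice_third {f : ℝ × ℝ × ℝ → ℝ} {q : ℝ × ℝ × ℝ}
    {f' : ℝ × ℝ × ℝ →L[ℝ] ℝ} (h : HasFDerivAt f f' q) :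
    HasDerivAt (fun t => f (q.1, q.2.1, t)) (f' (0, 0, 1)) q.2.2 :=
  HasFDerivAt.comp_hasDerivAt (l := f) q.2.2 h ((hasDerivAt_const q.2.2 q.1).prodMk
    ((hasDerivAt_const q.2.2 q.2.1).prodMk (hasDerivAt_id q.2.2)))

theorem AnalyticAtOrigin₂.eventually_hasFDerivAt (hF : AnalyticAtOrigin₂ F) :
    ∀ᶠ q : ℝ × ℝ in 𝓝 0, HasFDerivAt (fun q : ℝ × ℝ => F q.1 q.2)
      (fderiv ℝ (fun q : ℝ × ℝ => F q.1 q.2) q) q :=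
  hF.eventually_analyticAt.mono fun _ hq => hq.differentiableAt.hasFDerivAt

theorem AnalyticAtOrigin.eventually_hasFDerivAt (hJ : AnalyticAtOrigin J) :
    ∀ᶠ q : ℝ × ℝ × ℝ in 𝓝 0, HasFDerivAt (fun q : ℝ × ℝ × ℝ => J q.1 q.2.1 q.2.2)
      (fderiv ℝ (fun q : ℝ × ℝ × ℝ => J q.1 q.2.1 q.2.2) q) q :=
  hJ.eventually_analyticAt.mono fun _ hq => hq.differentiableAt.hasFDerivAt

theorem AnalyticAtOrigin₂.eventually_hasDerivAt_fst (hF : AnalyticAtOrigin₂ F) :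
    ∀ᶠ q : ℝ × ℝ in 𝓝 0, HasDerivAt (fun t => F t q.2) (partialX F q.1 q.2) q.1 :=
  hF.eventually_hasFDerivAt.mono fun _ hq =>
    (hasDerivAt_slice_fst hq).differentiableAt.hasDerivAt

theorem AnalyticAtOrigin.eventually_hasDerivAt_third (hJ : AnalyticAtOrigin J) :
    ∀ᶠ q : ℝ × ℝ × ℝ in 𝓝 0,
      HasDerivAt (fun t => J q.1 q.2.1 t) (partialP J q.1 q.2.1 q.2.2) q.2.2 :=
  hJ.eventually_hasFDerivAt.mono fun _ hq =>
    (hasDerivAt_slice_third hq).differentiableAt.hasDerivAt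

theorem AnalyticAtOrigin₂.partialX (hF : AnalyticAtOrigin₂ F) :
    AnalyticAtOrigin₂ (partialX F) :=
  (((ContinuousLinearMap.apply ℝ ℝ ((1, 0) : ℝ × ℝ)).analyticAt _).fun_comp hF.fderiv).congr <|
    hF.eventually_hasFDerivAt.mono fun _ hq => (hasDerivAt_slice_fst hq).deriv.symm

theorem AnalyticAtOrigin₂.partialY (hF : AnalyticAtOrigin₂ F) :
    AnalyticAtOrigin₂ (partialY F) :=
  (((ContinuousLinearMap.apply ℝ ℝ ((0, 1) : ℝ × ℝ)).analyticAt _).fun_comp hF.fderiv).congr <|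
    hF.eventually_hasFDerivAt.mono fun _ hq => (hasDerivAt_slice_snd hq).deriv.symm

theorem AnalyticAtOrigin.partialP (hJ : AnalyticAtOrigin J) : AnalyticAtOrigin (partialP J) :=
  (((ContinuousLinearMap.apply ℝ ℝ ((0, 0, 1) : ℝ × ℝ × ℝ)).analyticAt _).fun_comp hJ.fderiv).congr <|
    hJ.eventually_hasFDerivAt.mono fun _ hq => (hasDerivAt_slice_third hq).deriv.symm

/-- An identity can be differentiated at a point once it holds near that point on the coordinate
line; this supplies that at every point near `c`. -/
theorem eventually_eventually_fst {P : ℝ × ℝ → Prop} {c : ℝ × ℝ} (h : ∀ᶠ q in 𝓝 c, P q) :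
    ∀ᶠ q in 𝓝 c, ∀ᶠ t in 𝓝 q.1, P (t, q.2) :=
  h.eventually_nhds.mono fun q hq =>
    (show ContinuousAt (fun t : ℝ => (t, q.2)) q.1 by fun_prop).eventually hq

theorem eventually_eventually_snd {P : ℝ × ℝ → Prop} {c : ℝ × ℝ} (h : ∀ᶠ q in 𝓝 c, P q) :
    ∀ᶠ q in 𝓝 c, ∀ᶠ t in 𝓝 q.2, P (q.1, t) :=
  h.eventually_nhds.mono fun q hq =>
    (show ContinuousAt (fun t : ℝ => (q.1, t)) q.2 by fun_prop).eventually hq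

theorem eventually_eventually_third {P : ℝ × ℝ × ℝ → Prop} {c : ℝ × ℝ × ℝ}
    (h : ∀ᶠ q in 𝓝 c, P q) : ∀ᶠ q in 𝓝 c, ∀ᶠ t in 𝓝 q.2.2, P (q.1, q.2.1, t) :=
  h.eventually_nhds.mono fun q hq =>
    (show ContinuousAt (fun t : ℝ => (q.1, q.2.1, t)) q.2.2 by fun_prop).eventually hq

theorem eventually_partialX_eq {c : ℝ × ℝ} (h : ∀ᶠ q in 𝓝 c, F q.1 q.2 = G q.1 q.2) :
    ∀ᶠ q in 𝓝 c, partialX F q.1 q.2 = partialX G q.1 q.2 :=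
  (eventually_eventually_fst h).mono fun _ hq => EventuallyEq.deriv_eq hq

theorem eventually_partialY_eq {c : ℝ × ℝ} (h : ∀ᶠ q in 𝓝 c, F q.1 q.2 = G q.1 q.2) :
    ∀ᶠ q in 𝓝 c, partialY F q.1 q.2 = partialY G q.1 q.2 :=
  (eventually_eventually_snd h).mono fun _ hq => EventuallyEq.deriv_eq hq

theorem eventually_partialP_eq {c : ℝ × ℝ × ℝ}
    (h : ∀ᶠ q in 𝓝 c, J q.1 q.2.1 q.2.2 = K q.1 q.2.1 q.2.2) :
    ∀ᶠ q in 𝓝 c, partialP J q.1 q.2.1 q.2.2 = partialP K q.1 q.2.1 q.2.2 :=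
  (eventually_eventually_third h).mono fun _ hq => EventuallyEq.deriv_eq hq

theorem eventually_axis_fst {P : ℝ × ℝ → Prop} (h : ∀ᶠ q in 𝓝 0, P q) :
    ∀ᶠ x in 𝓝 (0 : ℝ), P (x, 0) :=
  (show Tendsto (fun t : ℝ => (t, (0 : ℝ))) (𝓝 0) (𝓝 0) from
    (by fun_prop : Continuous fun t : ℝ => (t, (0 : ℝ))).tendsto' _ _ rfl).eventually h

theorem eventually_axis_snd {P : ℝ × ℝ → Prop} (h : ∀ᶠ q in 𝓝 0, P q) :
    ∀ᶠ y in 𝓝 (0 : ℝ), P (0, y) :=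
  (show Tendsto (fun t : ℝ => ((0 : ℝ), t)) (𝓝 0) (𝓝 0) from
    (by fun_prop : Continuous fun t : ℝ => ((0 : ℝ), t)).tendsto' _ _ rfl).eventually h

theorem eventually_plane {P : ℝ × ℝ × ℝ → Prop} (h : ∀ᶠ q in 𝓝 0, P q) :
    ∀ᶠ q in 𝓝 (0 : ℝ × ℝ), P (q.1, q.2, 0) :=
  (show Tendsto (fun q : ℝ × ℝ => (q.1, q.2, (0 : ℝ))) (𝓝 0) (𝓝 0) from
    (by fun_prop : Continuous fun q : ℝ × ℝ => (q.1, q.2, (0 : ℝ))).tendsto' _ _ rfl).eventually h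

theorem eventually_of_plane {P : ℝ × ℝ → Prop} (h : ∀ᶠ q in 𝓝 0, P q) :
    ∀ᶠ q in 𝓝 (0 : ℝ × ℝ × ℝ), P (q.1, q.2.1) :=
  (show Tendsto (fun q : ℝ × ℝ × ℝ => (q.1, q.2.1)) (𝓝 0) (𝓝 0) from
    (by fun_prop : Continuous fun q : ℝ × ℝ × ℝ => (q.1, q.2.1)).tendsto' _ _ rfl).eventually h

theorem eventually_of_fst {P : ℝ → Prop} (h : ∀ᶠ x in 𝓝 0, P x) :
    ∀ᶠ q in 𝓝 (0 : ℝ × ℝ), P q.1 :=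
  (show Tendsto (fun q : ℝ × ℝ => q.1) (𝓝 0) (𝓝 0) from
    continuous_fst.tendsto' _ _ rfl).eventually h

theorem AnalyticAtOrigin₂.of_fst {φ : ℝ → ℝ} (h : AnalyticAt ℝ φ 0) :
    AnalyticAtOrigin₂ fun x _ => φ x :=
  AnalyticAt.fun_comp (g := φ) (f := Prod.fst) (x := (0 : ℝ × ℝ)) h analyticAt_fst

theorem AnalyticAtOrigin₂.comp {a b : ℝ × ℝ → ℝ} (hF : AnalyticAtOrigin₂ F)
    (ha : AnalyticAt ℝ a 0) (hb : AnalyticAt ℝ b 0) (ha0 : a 0 = 0) (hb0 : b 0 = 0) :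
    AnalyticAt ℝ (fun q => F (a q) (b q)) 0 := by
  refine AnalyticAt.comp_of_eq (g := fun q : ℝ × ℝ => F q.1 q.2) (f := fun q => (a q, b q))
    hF (ha.prod hb) ?_
  rw [ha0, hb0]; rfl

theorem AnalyticAtOrigin₂.lift (hF : AnalyticAtOrigin₂ F) :
    AnalyticAtOrigin fun x y _ => F x y :=
  AnalyticAt.fun_comp (g := fun q : ℝ × ℝ => F q.1 q.2)
    (f := fun q : ℝ × ℝ × ℝ => (q.1, q.2.1)) (x := (0 : ℝ × ℝ × ℝ)) hF
    (analyticAt_fst.prod (analyticAt_fst.fun_comp analyticAt_snd))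

theorem AnalyticAtOrigin.comp {E : Type*} [NormedAddCommGroup E] [NormedSpace ℝ E]
    {a b c : E → ℝ} {e : E} (hJ : AnalyticAtOrigin J) (ha : AnalyticAt ℝ a e)
    (hb : AnalyticAt ℝ b e) (hc : AnalyticAt ℝ c e) (ha0 : a e = 0) (hb0 : b e = 0)
    (hc0 : c e = 0) : AnalyticAt ℝ (fun q => J (a q) (b q) (c q)) e := by
  refine AnalyticAt.comp_of_eq (g := fun q : ℝ × ℝ × ℝ => J q.1 q.2.1 q.2.2)
    (f := fun q => (a q, b q, c q)) hJ (ha.prod (hb.prod hc)) ?_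
  rw [ha0, hb0, hc0]; rfl

end Partial

/-! ### The solution family and the reparametrization of `x`. -/

section Construction

/-- An analytic vector field has analytic integral curves. -/
theorem exists_analyticAt_curve {E : Type*} [NormedAddCommGroup E] [NormedSpace ℝ E]
    [CompleteSpace E] {f : E → E} {a₀ : E} (hf : AnalyticAt ℝ f a₀) :
    ∃ c : ℝ → E, AnalyticAt ℝ c 0 ∧ c 0 = a₀ ∧ ∀ᶠ t in 𝓝 (0 : ℝ), HasDerivAt c (f (c t)) t := by
  obtain ⟨Φ, hΦ, hΦ0, hΦd⟩ := exists_analyticAt_flow hf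
  refine ⟨fun t => Φ (t, a₀), ?_, hΦ0.self_of_nhds, ?_⟩
  · exact AnalyticAt.fun_comp (g := Φ) (f := fun t : ℝ => (t, a₀)) hΦ
      (analyticAt_id.prod analyticAt_const)
  · exact (show ContinuousAt (fun t : ℝ => (t, a₀)) 0 by fun_prop).eventually hΦd

/-- The second order equation `φ'' = - φ'² k(φ)` has an analytic solution tangent to the
identity. -/
theorem exists_reparametrization {k : ℝ → ℝ} (hk : AnalyticAt ℝ k 0) :
    ∃ φ : ℝ → ℝ, AnalyticAt ℝ φ 0 ∧ φ 0 = 0 ∧ deriv φ 0 = 1 ∧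
      ∀ᶠ x in 𝓝 0, deriv (deriv φ) x = -(deriv φ x) ^ 2 * k (φ x) := by
  -- The first-order system for `(φ, φ')`, started at `(0, 1)`.
  have hf : AnalyticAt ℝ (fun z : ℝ × ℝ => (z.2, -z.2 ^ 2 * k z.1)) ((0 : ℝ), (1 : ℝ)) := by
    refine analyticAt_snd.prod ((analyticAt_snd.pow 2).neg.mul ?_)
    exact AnalyticAt.fun_comp (g := k) (f := Prod.fst) hk analyticAt_fst
  obtain ⟨c, hc, hc0, hcd⟩ := exists_analyticAt_curve hf
  have h1 : ∀ᶠ x in 𝓝 0, deriv (fun x => (c x).1) x = (c x).2 :=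
    hcd.mono fun x hx => (hasDerivAt_fst_comp hx).deriv
  refine ⟨fun x => (c x).1, analyticAt_fst.fun_comp hc, congrArg Prod.fst hc0, ?_, ?_⟩
  · rw [h1.self_of_nhds, hc0]
  · filter_upwards [hcd, h1, h1.eventually_nhds] with x hx hx1 hx2
    rw [EventuallyEq.deriv_eq hx2, (hasDerivAt_snd_comp hx).deriv, hx1]

/-- A one-parameter family of solutions of `Y_XX = J (X, Y, Y_X)`, transversal to the fibres,
whose initial values and slopes are adapted to the first two derivatives of `J` in `P`. -/
theorem exists_solution_family {J : ℝ → ℝ → ℝ → ℝ} (hJ : AnalyticAtOrigin J) :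
    ∃ F : ℝ → ℝ → ℝ, AnalyticAtOrigin₂ F ∧ F 0 0 = 0 ∧ partialX F 0 0 = 0 ∧
      partialY F 0 0 = 1 ∧
      (∀ᶠ q : ℝ × ℝ in 𝓝 0, partialX (partialX F) q.1 q.2
        = J q.1 (F q.1 q.2) (partialX F q.1 q.2)) ∧
      (∀ᶠ y in 𝓝 0, partialY (partialX F) 0 y
        = partialY F 0 y * partialP J 0 (F 0 y) (partialX F 0 y) / 2) ∧
      (∀ᶠ y in 𝓝 0, partialY (partialY F) 0 y
        = partialY F 0 y ^ 2 * partialP (partialP J) 0 (F 0 y) (partialX F 0 y) / 2) := by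
  -- The unknown is `z = (F, F_Y, F_X)` along `X = 0` as a function of `y`; the last two components
  -- encode D4 and D2.
  have hf : AnalyticAt ℝ (fun z : ℝ × ℝ × ℝ =>
      (z.2.1, z.2.1 ^ 2 * partialP (partialP J) 0 z.1 z.2.2 / 2,
        z.2.1 * partialP J 0 z.1 z.2.2 / 2)) ((0 : ℝ), (1 : ℝ), (0 : ℝ)) := by
    have h2 : AnalyticAt ℝ (fun z : ℝ × ℝ × ℝ => z.2.1) ((0 : ℝ), (1 : ℝ), (0 : ℝ)) :=
      analyticAt_fst.fun_comp analyticAt_snd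
    have h3 : AnalyticAt ℝ (fun z : ℝ × ℝ × ℝ => z.2.2) ((0 : ℝ), (1 : ℝ), (0 : ℝ)) :=
      analyticAt_snd.fun_comp analyticAt_snd
    refine h2.prod (AnalyticAt.prod ?_ ?_)
    · exact ((h2.pow 2).mul (hJ.partialP.partialP.comp analyticAt_const analyticAt_fst h3
        rfl rfl rfl)).div analyticAt_const (by norm_num)
    · exact (h2.mul (hJ.partialP.comp analyticAt_const analyticAt_fst h3
        rfl rfl rfl)).div analyticAt_const (by norm_num)
  obtain ⟨c, hc, hc0, hcd⟩ := exists_analyticAt_curve hf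
  -- The equation as an autonomous system for `(X, Y, P)`, with `X` moving at unit speed.
  have hv : AnalyticAt ℝ (fun z : ℝ × ℝ × ℝ => ((1 : ℝ), z.2.2, J z.1 z.2.1 z.2.2)) 0 :=
    analyticAt_const.prod ((analyticAt_snd.fun_comp analyticAt_snd).prod hJ)
  obtain ⟨Φ, hΦ, hΦ0, hΦd⟩ := exists_analyticAt_flow hv
  let a : ℝ → ℝ × ℝ × ℝ := fun y => (0, (c y).1, (c y).2.2)
  have ha : AnalyticAt ℝ a 0 := analyticAt_const.prod ((analyticAt_fst.fun_comp hc).prod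
    (analyticAt_snd.fun_comp (analyticAt_snd.fun_comp hc)))
  have ha0 : a 0 = 0 := by simp only [a, hc0]; rfl
  let i : ℝ × ℝ → ℝ × ℝ × ℝ × ℝ := fun q => (q.1, a q.2)
  have hi : AnalyticAt ℝ i 0 := analyticAt_fst.prod
    (AnalyticAt.fun_comp (g := a) (f := Prod.snd) (x := (0 : ℝ × ℝ)) ha analyticAt_snd)
  have hi0 : i 0 = (0, 0) := by
    change ((0 : ℝ), a 0) = (0, 0)
    rw [ha0]
  have hΦi : AnalyticAt ℝ (fun q => Φ (i q)) 0 := AnalyticAt.comp_of_eq hΦ hi hi0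
  have hflow : ∀ᶠ q : ℝ × ℝ in 𝓝 0, HasDerivAt (fun t => Φ (t, a q.2))
      ((1 : ℝ), (Φ (i q)).2.2, J (Φ (i q)).1 (Φ (i q)).2.1 (Φ (i q)).2.2) q.1 := by
    have h := hi.continuousAt.tendsto
    rw [hi0] at h
    exact h.eventually hΦd
  have hinit : ∀ᶠ y in 𝓝 (0 : ℝ), Φ (0, a y) = a y := by
    have h := ha.continuousAt.tendsto
    rw [ha0] at h
    exact h.eventually hΦ0
  -- `X - t` has zero derivative along the flow and vanishes at `t = 0`. The argument needs a whole
  -- interval of times, which the sup-metric ball provides.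
  have htime : ∀ᶠ q : ℝ × ℝ in 𝓝 0, (Φ (i q)).1 = q.1 := by
    obtain ⟨δ, hδ, H⟩ := Metric.eventually_nhds_iff.1
      (hflow.and ((show Tendsto (fun q : ℝ × ℝ => q.2) (𝓝 0) (𝓝 0) from
        continuous_snd.tendsto' _ _ rfl).eventually hinit))
    refine Metric.eventually_nhds_iff.2 ⟨δ, hδ, fun q hq => ?_⟩
    obtain ⟨x, y⟩ := q
    have hxy : dist x 0 < δ ∧ dist y 0 < δ := by
      have : dist (x, y) ((0 : ℝ), (0 : ℝ)) < δ := hq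
      rwa [Prod.dist_eq, max_lt_iff] at this
    have hball : ∀ t ∈ Metric.ball (0 : ℝ) δ, dist (t, y) (0 : ℝ × ℝ) < δ := by
      intro t ht
      change dist (t, y) ((0 : ℝ), (0 : ℝ)) < δ
      rw [Prod.dist_eq]
      exact max_lt ht hxy.2
    have hder : ∀ t ∈ Metric.ball (0 : ℝ) δ,
        HasDerivAt (fun t => (Φ (t, a y)).1 - t) 0 t := by
      intro t ht
      have h := (hasDerivAt_fst_comp (H (hball t ht)).1).sub (hasDerivAt_id t)
      rw [sub_self] at h
      exact h
    have hconst := Metric.isOpen_ball.is_const_of_deriv_eq_zero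
      (convex_ball (0 : ℝ) δ).isPreconnected
      (fun t ht => (hder t ht).differentiableAt.differentiableWithinAt)
      (fun t ht => (hder t ht).deriv) (show x ∈ Metric.ball (0 : ℝ) δ from hxy.1)
      (Metric.mem_ball_self hδ)
    have h0 : Φ (0, a y) = a y := (H (hball 0 (Metric.mem_ball_self hδ))).2
    simp only [h0, sub_zero] at hconst
    exact sub_eq_zero.1 hconst
  let F : ℝ → ℝ → ℝ := fun x y => (Φ (x, a y)).2.1
  let H : ℝ → ℝ → ℝ := fun x y => (Φ (x, a y)).2.2
  have hF : AnalyticAtOrigin₂ F := analyticAt_fst.fun_comp (analyticAt_snd.fun_comp hΦi)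
  have hFX : ∀ᶠ q : ℝ × ℝ in 𝓝 0, partialX F q.1 q.2 = H q.1 q.2 :=
    hflow.mono fun q hq => (hasDerivAt_fst_comp (hasDerivAt_snd_comp hq)).deriv
  have hF0 : ∀ᶠ y in 𝓝 (0 : ℝ), F 0 y = (c y).1 :=
    hinit.mono fun y hy => by simp only [F, hy, a]
  have hFX0 : ∀ᶠ y in 𝓝 (0 : ℝ), partialX F 0 y = (c y).2.2 := by
    filter_upwards [hinit, eventually_axis_snd hFX] with y hy h
    simp only [h, H, hy, a]
  have hFY0 : ∀ᶠ y in 𝓝 (0 : ℝ), partialY F 0 y = (c y).2.1 := by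
    filter_upwards [hF0.eventually_nhds, hcd] with y hy h
    exact (EventuallyEq.deriv_eq hy).trans (hasDerivAt_fst_comp h).deriv
  refine ⟨F, hF, ?_, ?_, ?_, ?_, ?_, ?_⟩
  · rw [hF0.self_of_nhds, hc0]
  · rw [hFX0.self_of_nhds, hc0]
  · rw [hFY0.self_of_nhds, hc0]
  · filter_upwards [eventually_partialX_eq hFX, hFX, hflow, htime] with q h1 h2 h3 h4
    rw [h1, h2]
    have h5 := (hasDerivAt_snd_comp (hasDerivAt_snd_comp h3)).deriv
    simp only [h4] at h5
    exact h5
  · filter_upwards [hFX0.eventually_nhds, hFX0, hFY0, hF0, hcd] with y h1 h2 h3 h4 h5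
    rw [h2, h3, h4]
    exact (EventuallyEq.deriv_eq h1).trans (hasDerivAt_snd_comp (hasDerivAt_snd_comp h5)).deriv
  · filter_upwards [hFY0.eventually_nhds, hFX0, hFY0, hF0, hcd] with y h1 h2 h3 h4 h5
    rw [h2, h3, h4]
    exact (EventuallyEq.deriv_eq h1).trans (hasDerivAt_fst_comp (hasDerivAt_snd_comp h5)).deriv

end Construction

/-! ### Derivatives of `F (φ x) y`. -/

section Pullback

variable {F : ℝ → ℝ → ℝ} {φ : ℝ → ℝ}

theorem tendsto_reparam (hφ : AnalyticAt ℝ φ 0) (hφ0 : φ 0 = 0) :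
    Tendsto (fun q : ℝ × ℝ => (φ q.1, q.2)) (𝓝 0) (𝓝 0) := by
  have h : ContinuousAt (fun q : ℝ × ℝ => (φ q.1, q.2)) 0 :=
    (ContinuousAt.comp (g := φ) (f := Prod.fst) (x := (0 : ℝ × ℝ)) hφ.continuousAt
      continuousAt_fst).prodMk continuousAt_snd
  have h' := h.tendsto
  simp only [Prod.fst_zero, Prod.snd_zero, hφ0] at h'
  exact h'

theorem AnalyticAtOrigin₂.reparam (hF : AnalyticAtOrigin₂ F) (hφ : AnalyticAt ℝ φ 0)
    (hφ0 : φ 0 = 0) : AnalyticAtOrigin₂ fun x y => F (φ x) y :=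
  hF.comp (AnalyticAtOrigin₂.of_fst hφ) analyticAt_snd hφ0 rfl

theorem eventually_partialX_reparam (hF : AnalyticAtOrigin₂ F) (hφ : AnalyticAt ℝ φ 0)
    (hφ0 : φ 0 = 0) : ∀ᶠ q : ℝ × ℝ in 𝓝 0, HasDerivAt (fun t => F (φ t) q.2)
      (partialX F (φ q.1) q.2 * deriv φ q.1) q.1 := by
  filter_upwards [(tendsto_reparam hφ hφ0).eventually hF.eventually_hasDerivAt_fst,
    eventually_of_fst hφ.eventually_analyticAt] with q h1 h2
  exact HasDerivAt.comp q.1 h1 h2.differentiableAt.hasDerivAt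

theorem eventually_partialX_partialX_reparam (hF : AnalyticAtOrigin₂ F) (hφ : AnalyticAt ℝ φ 0)
    (hφ0 : φ 0 = 0) : ∀ᶠ q : ℝ × ℝ in 𝓝 0,
      partialX (partialX fun x y => F (φ x) y) q.1 q.2
        = partialX (partialX F) (φ q.1) q.2 * deriv φ q.1 ^ 2
          + partialX F (φ q.1) q.2 * deriv (deriv φ) q.1 := by
  filter_upwards [eventually_partialX_eq (F := partialX fun x y => F (φ x) y)
      (G := fun x y => partialX F (φ x) y * deriv φ x)
      ((eventually_partialX_reparam hF hφ hφ0).mono fun q hq => hq.deriv),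
    eventually_partialX_reparam hF.partialX hφ hφ0,
    eventually_of_fst hφ.deriv.eventually_analyticAt] with q h1 h2 h3
  rw [h1]
  refine (h2.mul h3.differentiableAt.hasDerivAt).deriv.trans ?_
  ring

theorem eventually_partialY_partialX_reparam (hF : AnalyticAtOrigin₂ F) (hφ : AnalyticAt ℝ φ 0)
    (hφ0 : φ 0 = 0) : ∀ᶠ q : ℝ × ℝ in 𝓝 0,
      partialY (partialX fun x y => F (φ x) y) q.1 q.2
        = partialY (partialX F) (φ q.1) q.2 * deriv φ q.1 := by
  filter_upwards [eventually_partialY_eq (F := partialX fun x y => F (φ x) y)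
      (G := fun x y => partialX F (φ x) y * deriv φ x)
      ((eventually_partialX_reparam hF hφ hφ0).mono fun q hq => hq.deriv)] with q h1
  rw [h1]
  exact deriv_mul_const_field _

end Pullback

/-! ### The transformed equation and its first two `p`-derivatives. -/

section Transform

/-- The right-hand side of the equation obtained from `Y_XX = J (X, Y, P)` by the change of
variables `X = φ x`, `Y = ψ (x, y)`. -/
noncomputable def pullbackRHS (φ : ℝ → ℝ) (ψ : ℝ → ℝ → ℝ) (J : ℝ → ℝ → ℝ → ℝ) (x y p : ℝ) : ℝ :=
  (deriv φ x ^ 3 * J (φ x) (ψ x y) (prolongP φ ψ x y p)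
    - (deriv φ x * partialY (partialY ψ) x y * p ^ 2
      + 2 * deriv φ x * partialY (partialX ψ) x y * p
      + deriv φ x * partialX (partialX ψ) x y
      + (-partialX ψ x y - partialY ψ x y * p) * deriv (deriv φ) x))
    / (partialY ψ x y * deriv φ x)

/-- The first `p`-derivative of `pullbackRHS`. -/
noncomputable def pullbackRHSDeriv (φ : ℝ → ℝ) (ψ : ℝ → ℝ → ℝ) (J : ℝ → ℝ → ℝ → ℝ)
    (x y p : ℝ) : ℝ :=
  (deriv φ x ^ 3 * (partialP J (φ x) (ψ x y) (prolongP φ ψ x y p) * (partialY ψ x y / deriv φ x))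
    - (deriv φ x * partialY (partialY ψ) x y * (2 * p)
      + 2 * deriv φ x * partialY (partialX ψ) x y
      - partialY ψ x y * deriv (deriv φ) x))
    / (partialY ψ x y * deriv φ x)

variable {φ : ℝ → ℝ} {ψ : ℝ → ℝ → ℝ} {J : ℝ → ℝ → ℝ → ℝ}

theorem hasDerivAt_prolongP (x y p : ℝ) :
    HasDerivAt (fun t => prolongP φ ψ x y t) (partialY ψ x y / deriv φ x) p := by
  have h := (((hasDerivAt_id p).const_mul (partialY ψ x y)).const_add (partialX ψ x y)).div_const
    (deriv φ x)
  rw [mul_one] at h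
  exact h

theorem IsFibrePreservingAtOrigin.analyticAtOrigin₂ (h : IsFibrePreservingAtOrigin φ ψ) :
    AnalyticAtOrigin₂ ψ := h.analytic_snd

theorem analyticAtOrigin_prolongP (h : IsFibrePreservingAtOrigin φ ψ) :
    AnalyticAtOrigin (prolongP φ ψ) :=
  (h.analyticAtOrigin₂.partialX.lift.add (h.analyticAtOrigin₂.partialY.lift.mul
    (analyticAt_snd.fun_comp analyticAt_snd))).div
    (AnalyticAtOrigin₂.of_fst h.analytic_fst.deriv).lift h.fst_deriv_ne_zero

theorem AnalyticAtOrigin.prolong (hJ : AnalyticAtOrigin J) (h : IsFibrePreservingAtOrigin φ ψ)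
    (hP : prolongP φ ψ 0 0 0 = 0) :
    AnalyticAtOrigin fun x y p => J (φ x) (ψ x y) (prolongP φ ψ x y p) :=
  hJ.comp (AnalyticAtOrigin₂.of_fst h.analytic_fst).lift h.analyticAtOrigin₂.lift
    (analyticAtOrigin_prolongP h) h.fst_origin h.snd_origin hP

theorem analyticAtOrigin_pullbackRHS (hJ : AnalyticAtOrigin J)
    (h : IsFibrePreservingAtOrigin φ ψ) (hP : prolongP φ ψ 0 0 0 = 0) :
    AnalyticAtOrigin (pullbackRHS φ ψ J) := by
  have hψ := h.analyticAtOrigin₂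
  have hφ' := (AnalyticAtOrigin₂.of_fst h.analytic_fst.deriv).lift
  have hφ'' := (AnalyticAtOrigin₂.of_fst h.analytic_fst.deriv.deriv).lift
  have hp : AnalyticAtOrigin fun _ _ p => p := analyticAt_snd.fun_comp analyticAt_snd
  have h2 : AnalyticAtOrigin fun _ _ _ => 2 := analyticAt_const
  refine AnalyticAt.div (AnalyticAt.sub ?_ ?_) ?_ ?_
  · exact AnalyticAt.mul (AnalyticAt.pow hφ' 3) (hJ.prolong h hP)
  · refine AnalyticAt.add (AnalyticAt.add (AnalyticAt.add ?_ ?_) ?_) ?_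
    · exact AnalyticAt.mul (AnalyticAt.mul hφ' hψ.partialY.partialY.lift) (AnalyticAt.pow hp 2)
    · exact AnalyticAt.mul (AnalyticAt.mul (AnalyticAt.mul h2 hφ') hψ.partialX.partialY.lift) hp
    · exact AnalyticAt.mul hφ' hψ.partialX.partialX.lift
    · exact AnalyticAt.mul (AnalyticAt.sub (AnalyticAt.neg hψ.partialX.lift)
        (AnalyticAt.mul hψ.partialY.lift hp)) hφ''
  · exact AnalyticAt.mul hψ.partialY.lift hφ'
  · exact mul_ne_zero h.snd_partialY_ne_zero h.fst_deriv_ne_zero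

theorem IsFibrePreservingAtOrigin.eventually_ne_zero (h : IsFibrePreservingAtOrigin φ ψ) :
    ∀ᶠ q : ℝ × ℝ in 𝓝 0, deriv φ q.1 ≠ 0 ∧ partialY ψ q.1 q.2 ≠ 0 :=
  (eventually_of_fst (h.analytic_fst.deriv.continuousAt.eventually_ne h.fst_deriv_ne_zero)).and
    (h.analyticAtOrigin₂.partialY.continuousAt.eventually_ne h.snd_partialY_ne_zero)

/-- `Y_XX` is affine in `u` with slope `ψ_y / φ_x²`, nonzero near the origin, and `pullbackRHS` is
the result of solving for `u`. -/
theorem transforms_pullbackRHS (h : IsFibrePreservingAtOrigin φ ψ) (hP : prolongP φ ψ 0 0 0 = 0) :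
    Transforms φ ψ J (pullbackRHS φ ψ J) := by
  refine ⟨⟨h.fst_origin, h.snd_origin, hP⟩, ?_⟩
  filter_upwards [eventually_of_plane h.eventually_ne_zero] with q ⟨h1, h2⟩ u
  simp only [equationManifold, prolongation, Set.mem_ofPred_eq, prolongYXX, pullbackRHS]
  rw [div_eq_iff (pow_ne_zero 3 h1), eq_div_iff (mul_ne_zero h2 h1)]
  constructor <;> intro H <;> linarith

theorem tendsto_prolong (h : IsFibrePreservingAtOrigin φ ψ) (hP : prolongP φ ψ 0 0 0 = 0) :
    Tendsto (fun q : ℝ × ℝ × ℝ => (φ q.1, ψ q.1 q.2.1, prolongP φ ψ q.1 q.2.1 q.2.2))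
      (𝓝 0) (𝓝 0) := by
  have hc := (AnalyticAtOrigin₂.of_fst h.analytic_fst).lift.continuousAt.prodMk
    (h.analyticAtOrigin₂.lift.continuousAt.prodMk (analyticAtOrigin_prolongP h).continuousAt)
  have ht := hc.tendsto
  simp only [Prod.fst_zero, Prod.snd_zero, h.fst_origin, h.snd_origin, hP] at ht
  exact ht

theorem eventually_hasDerivAt_prolong (hJ : AnalyticAtOrigin J)
    (h : IsFibrePreservingAtOrigin φ ψ) (hP : prolongP φ ψ 0 0 0 = 0) :
    ∀ᶠ q : ℝ × ℝ × ℝ in 𝓝 0,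
      HasDerivAt (fun t => J (φ q.1) (ψ q.1 q.2.1) (prolongP φ ψ q.1 q.2.1 t))
        (partialP J (φ q.1) (ψ q.1 q.2.1) (prolongP φ ψ q.1 q.2.1 q.2.2)
          * (partialY ψ q.1 q.2.1 / deriv φ q.1)) q.2.2 :=
  ((tendsto_prolong h hP).eventually hJ.eventually_hasDerivAt_third).mono fun q hq =>
    HasDerivAt.comp (h₂ := fun t => J (φ q.1) (ψ q.1 q.2.1) t) q.2.2 hq (hasDerivAt_prolongP _ _ _)

theorem eventually_partialP_pullbackRHS (hJ : AnalyticAtOrigin J)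
    (h : IsFibrePreservingAtOrigin φ ψ) (hP : prolongP φ ψ 0 0 0 = 0) :
    ∀ᶠ q : ℝ × ℝ × ℝ in 𝓝 0, partialP (pullbackRHS φ ψ J) q.1 q.2.1 q.2.2
      = pullbackRHSDeriv φ ψ J q.1 q.2.1 q.2.2 := by
  filter_upwards [eventually_hasDerivAt_prolong hJ h hP] with ⟨x, y, p⟩ hq
  have h1 := (hasDerivAt_pow 2 p).const_mul (deriv φ x * partialY (partialY ψ) x y)
  have h2 := (hasDerivAt_id p).const_mul (2 * deriv φ x * partialY (partialX ψ) x y)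
  have h3 := (((hasDerivAt_id p).const_mul (partialY ψ x y)).const_sub
    (-partialX ψ x y)).mul_const (deriv (deriv φ) x)
  have h4 := ((h1.add h2).add_const (deriv φ x * partialX (partialX ψ) x y)).add h3
  have h5 := ((hq.const_mul (deriv φ x ^ 3)).sub h4).div_const (partialY ψ x y * deriv φ x)
  refine h5.deriv.trans ?_
  simp only [pullbackRHSDeriv]
  congr 2
  norm_num
  ring

theorem eventually_partialP_partialP_pullbackRHS (hJ : AnalyticAtOrigin J)
    (h : IsFibrePreservingAtOrigin φ ψ) (hP : prolongP φ ψ 0 0 0 = 0) :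
    ∀ᶠ q : ℝ × ℝ × ℝ in 𝓝 0, partialP (partialP (pullbackRHS φ ψ J)) q.1 q.2.1 q.2.2
      = (deriv φ q.1 ^ 3 * (partialP (partialP J) (φ q.1) (ψ q.1 q.2.1)
          (prolongP φ ψ q.1 q.2.1 q.2.2) * (partialY ψ q.1 q.2.1 / deriv φ q.1) ^ 2)
        - 2 * deriv φ q.1 * partialY (partialY ψ) q.1 q.2.1)
        / (partialY ψ q.1 q.2.1 * deriv φ q.1) := by
  filter_upwards [eventually_partialP_eq (eventually_partialP_pullbackRHS hJ h hP),
    eventually_hasDerivAt_prolong hJ.partialP h hP] with ⟨x, y, p⟩ h0 hq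
  rw [h0]
  have h1 := (((hasDerivAt_id p).const_mul 2).const_mul
    (deriv φ x * partialY (partialY ψ) x y))
  have h2 := (h1.add_const (2 * deriv φ x * partialY (partialX ψ) x y)).sub_const
    (partialY ψ x y * deriv (deriv φ) x)
  have h5 := (((hq.mul_const (partialY ψ x y / deriv φ x)).const_mul (deriv φ x ^ 3)).sub
    h2).div_const (partialY ψ x y * deriv φ x)
  refine h5.deriv.trans ?_
  congr 2 <;> ring

end Transform

/-! ### Assembly of the normal form. -/

/-- Every analytic equation `Y_XX = J (X, Y, P)` can be brought into normal form. -/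
theorem exists_normalForm {J : ℝ → ℝ → ℝ → ℝ} (hJ : AnalyticAtOrigin J) :
    ∃ (φ : ℝ → ℝ) (ψ : ℝ → ℝ → ℝ) (K : ℝ → ℝ → ℝ → ℝ),
      IsFibrePreservingAtOrigin φ ψ ∧ AnalyticAtOrigin K ∧ Transforms φ ψ J K ∧
        IsNormalForm K := by
  obtain ⟨F, hF, hF0, hFX0, hFY0, hXX, hXY, hYY⟩ := exists_solution_family hJ
  have hax : ∀ {G : ℝ → ℝ → ℝ}, AnalyticAtOrigin₂ G → AnalyticAt ℝ (fun x => G x 0) 0 := by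
    intro G hG
    exact AnalyticAt.fun_comp (g := fun q : ℝ × ℝ => G q.1 q.2) (f := fun x : ℝ => (x, (0 : ℝ)))
      hG (analyticAt_id.prod analyticAt_const)
  let k : ℝ → ℝ := fun x => partialP J x (F x 0) (partialX F x 0)
    - 2 * partialY (partialX F) x 0 / partialY F x 0
  have hk : AnalyticAt ℝ k 0 :=
    (hJ.partialP.comp analyticAt_id (hax hF) (hax hF.partialX) rfl hF0 hFX0).sub
      ((analyticAt_const.mul (hax hF.partialX.partialY)).div (hax hF.partialY)
        (by rw [hFY0]; exact one_ne_zero))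
  -- This forces `φ''(0) = 0`, without which the reparametrization would spoil D2.
  have hk0 : k 0 = 0 := by
    have h := hXY.self_of_nhds
    simp only [k, h, hFY0]
    ring
  obtain ⟨φ, hφ, hφ0, hφ'0, hφ''⟩ := exists_reparametrization hk
  have hφ''0 : deriv (deriv φ) 0 = 0 := by
    rw [hφ''.self_of_nhds, hφ0, hk0, mul_zero]
  let ψ : ℝ → ℝ → ℝ := fun x y => F (φ x) y
  have hψX := (eventually_partialX_reparam hF hφ hφ0).mono fun q hq => hq.deriv
  have hψXX := eventually_partialX_partialX_reparam hF hφ hφ0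
  have hψXY := eventually_partialY_partialX_reparam hF hφ hφ0
  have hfib : IsFibrePreservingAtOrigin φ ψ :=
    { analytic_fst := hφ
      analytic_snd := hF.reparam hφ hφ0
      fst_origin := hφ0
      snd_origin := by simp only [ψ, hφ0, hF0]
      fst_deriv_ne_zero := by rw [hφ'0]; exact one_ne_zero
      snd_partialY_ne_zero := by
        change partialY F (φ 0) 0 ≠ 0
        rw [hφ0, hFY0]
        exact one_ne_zero }
  have hne := hfib.eventually_ne_zero
  -- At `p = 0` the prolonged slope is that of the solution through the point, so `J` and its
  -- `P`-derivatives get evaluated along the family `F`.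
  have hprol : ∀ᶠ q : ℝ × ℝ in 𝓝 0, prolongP φ ψ q.1 q.2 0 = partialX F (φ q.1) q.2 := by
    filter_upwards [hψX, hne] with q h1 h2
    change partialX ψ q.1 q.2 = _ at h1
    rw [prolongP, h1, mul_zero, add_zero, mul_div_cancel_right₀ _ h2.1]
  have hP : prolongP φ ψ 0 0 0 = 0 := by
    have h := hprol.self_of_nhds
    simp only [Prod.fst_zero, Prod.snd_zero, hφ0, hFX0] at h
    exact h
  have hK1 := eventually_plane (eventually_partialP_pullbackRHS hJ hfib hP)
  have hK2 := eventually_plane (eventually_partialP_partialP_pullbackRHS hJ hfib hP)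
  refine ⟨φ, ψ, pullbackRHS φ ψ J, hfib, analyticAtOrigin_pullbackRHS hJ hfib hP,
    transforms_pullbackRHS hfib hP, ⟨?_, ?_, ?_, ?_⟩⟩
  -- D1: the `φ''` terms cancel, and what is left is the equation solved by `F`.
  · filter_upwards [hψX, hψXX, hprol, (tendsto_reparam hφ hφ0).eventually hXX]
      with q h1 h2 h3 h4
    change partialX ψ q.1 q.2 = _ at h1
    change partialX (partialX ψ) q.1 q.2 = _ at h2
    rw [pullbackRHS, h1, h2, h3, h4]
    simp only [ψ]
    rw [div_eq_zero_iff]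
    left
    ring
  · filter_upwards [eventually_axis_snd hK1, eventually_axis_snd hprol, eventually_axis_snd hψXY,
      hXY] with y h1 h2 h3 h4
    change partialY (partialX ψ) 0 y = _ at h3
    have h5 : partialY ψ 0 y = partialY F (φ 0) y := rfl
    rw [h1, pullbackRHSDeriv, h2, h3, h5]
    simp only [ψ, hφ0, hφ'0, hφ''0, h4]
    rw [div_eq_zero_iff]
    left
    ring
  -- D3: after division by `F_Y`, the numerator is `φ'' + φ'² k(φ)`.
  · filter_upwards [eventually_axis_fst hK1, eventually_axis_fst hprol, eventually_axis_fst hψXY,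
      hφ'', eventually_axis_fst hne] with x h1 h2 h3 h4 h6
    change partialY (partialX ψ) x 0 = _ at h3
    have h5 : partialY ψ x 0 = partialY F (φ x) 0 := rfl
    obtain ⟨h6, h7⟩ := h6
    simp only [h5] at h6 h7
    rw [h1, pullbackRHSDeriv, h2, h3, h5, h4]
    simp only [ψ, k]
    rw [div_eq_zero_iff]
    left
    field_simp
    ring
  · filter_upwards [eventually_axis_snd hK2, eventually_axis_snd hprol, hYY] with y h1 h2 h3
    have h4 : partialY ψ 0 y = partialY F (φ 0) y := rfl
    have h5 : partialY (partialY ψ) 0 y = partialY (partialY F) (φ 0) y := rfl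
    rw [h1, h2, h4, h5]
    simp only [ψ, hφ0, hφ'0, h3]
    rw [div_eq_zero_iff]
    left
    ring

end SecondOrderODE

theorem theorem6p42 (J : ℝ → ℝ → ℝ → ℝ) (hJ : SecondOrderODE.AnalyticAtOrigin J) :
    ∃ (φ : ℝ → ℝ) (ψ : ℝ → ℝ → ℝ) (K : ℝ → ℝ → ℝ → ℝ),
      SecondOrderODE.IsFibrePreservingAtOrigin φ ψ ∧
      SecondOrderODE.AnalyticAtOrigin K ∧
      SecondOrderODE.Transforms φ ψ J K ∧
      SecondOrderODE.IsNormalForm K :=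
  SecondOrderODE.exists_normalForm hJ
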